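/- All graphs are simple, unweighted, non-empty and connected, but not necessarily finite; $d=d_G$ is the shortest-path metric of a graph $G$. For vertices $x,y,u,v$ let $\delta_G(x,y,u,v)$ be the difference between the largest and the second largest of the three numbers $$\tfrac{d(u,v)+d(x,y)}{2},\qquad \tfrac{d(u,x)+d(v,y)}{2},\qquad \tfrac{d(u,y)+d(v,x)}{2}.$$ $G$ is $\delta$-hyperbolic if $\delta_G(x,y,u,v)\le\delta$ for all vertices $x,y,u,v$, and the hyperbolicity $\delta^*(G)\in\{0,\tfrac12,1,\tfrac32,\dots\}\cup\{\infty\}$ is the least $\delta\in\{0,\tfrac12,1,\dots\}$ such that $G$ is $\delta$-hyperbolic ($\infty$ if there is none). A subgraph $H$ of $G$ is isometric if $d_H(u,v)=d_G(u,v)$ for all vertices $u,v$ of $H$. $G$ is chordal if it has no induced $n$-cycle with $n>3$; distance-hereditary if each of its induced (finite) paths is isometric; and a cograph if it has no induced path of length $3$ (that is, on four vertices). Then: (1) Every distance-hereditary graph is $1$-hyperbolic. Moreover, for a distance-hereditary graph $G$ the following are equivalent: $G$ is $\tfrac12$-hyperbolic; $G$ is chordal; $G$ contains no induced $4$-cycle.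 (2) Every cograph is $1$-hyperbolic, and a cograph $G$ has hyperbolicity $\delta^*(G)=1$ if and only if it contains the $4$-cycle $C_4$ as an isometric subgraph. -/

import Mathlib

open scoped ENNReal

namespace SimpleGraph

/-- A subgraph `H` of `G` is isometric if `d_H(u,v) = d_G(u,v)` for all vertices `u, v` of `H`
(the extended distance is used, so that vertices in different components of `H` are at
distance `⊤`). -/
def Subgraph.IsIsometric {V : Type*} {G : SimpleGraph V} (H : G.Subgraph) : Prop :=
  ∀ u v : H.verts, H.coe.edist u v = G.edist (u : V) (v : V)

/-- `G` contains (a copy of) the graph `F` as an isometric subgraph. -/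
def ContainsIsometric {V W : Type*} (G : SimpleGraph V) (F : SimpleGraph W) : Prop :=
  ∃ H : G.Subgraph, Nonempty (H.coe ≃g F) ∧ H.IsIsometric

/-- `G` is `k`-chordal if it contains no induced `n`-cycle with `n > k` (a cycle has at least
three vertices). -/
def IsKChordal {V : Type*} (G : SimpleGraph V) (k : ℕ) : Prop :=
  ∀ n : ℕ, 3 ≤ n → k < n → ¬ cycleGraph n ⊴ G

/-- A chordal graph is a `3`-chordal graph. -/
def IsChordal {V : Type*} (G : SimpleGraph V) : Prop :=
  G.IsKChordal 3

/-- `G` is distance-hereditary if each of its induced paths is isometric. The graph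
`pathGraph (n + 1)` is the path of length `n`. -/
def IsDistanceHereditary {V : Type*} (G : SimpleGraph V) : Prop :=
  ∀ H : G.Subgraph, H.IsInduced → (∃ n : ℕ, Nonempty (H.coe ≃g pathGraph (n + 1))) →
    H.IsIsometric

/-- `G` is a cograph if it has no induced path of length `3`, i.e. on four vertices. -/
def IsCograph {V : Type*} (G : SimpleGraph V) : Prop :=
  ¬ pathGraph 4 ⊴ G

/-- The difference between the largest and the second largest of the three numbers
`a`, `b`, `c` (counted with multiplicity). -/
noncomputable def gapOfLargest (a b c : ℝ) : ℝ :=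
  max a (max b c) - max (min a b) (max (min a c) (min b c))

/-- The number `δ_G(x, y, u, v)`: the difference between the largest and the second largest of
`(uv + xy) / 2`, `(ux + vy) / 2` and `(uy + vx) / 2`. -/
noncomputable def fourPointDelta {V : Type*} (G : SimpleGraph V) (x y u v : V) : ℝ :=
  gapOfLargest (((G.dist u v : ℝ) + G.dist x y) / 2) (((G.dist u x : ℝ) + G.dist v y) / 2)
    (((G.dist u y : ℝ) + G.dist v x) / 2)

/-- `G` is `δ`-hyperbolic. -/
def IsHyperbolic {V : Type*} (G : SimpleGraph V) (δ : ℝ) : Prop :=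
  ∀ x y u v : V, G.fourPointDelta x y u v ≤ δ

/-- The hyperbolicity `δ*(G)`: the least `δ` among `0, 1/2, 1, 3/2, …` such that `G` is
`δ`-hyperbolic, and `∞` if there is none. -/
noncomputable def hyperbolicity {V : Type*} (G : SimpleGraph V) : ℝ≥0∞ :=
  ⨅ (k : ℕ) (_ : G.IsHyperbolic ((k : ℝ) / 2)), (k : ℝ≥0∞) / 2

end SimpleGraph

/-!
In a distance-hereditary graph every connected induced subgraph is isometric, because a shortest
path inside it is an induced path of the whole graph
(`IsDistanceHereditary.exists_walk_support_subset`). The argument rests on one consequence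
(`IsDistanceHereditary.adj_of_joinedAbove`): if `x` and `y` lie at distance `k + 1` from `v` and
are joined by a walk avoiding the ball of radius `k` around `v`, then `x` and `y` have the same
neighbours at distance `k` from `v`.

Fix `v`, and let `m` be the largest number such that the vertices `x` and `y` are joined by a walk
that stays at distance at least `m` from `v`. A shortest path from `x` to `y` meets the sphere of
radius `m` or its inside, so the Gromov product of `x` and `y` at `v` is at most `m`; on the other
hand, the points at distance `m` from `v` on shortest paths to `x` and to `y` have a common
neighbour, so the product is at least `m - 1`. Since `m`, as a function of the pair `{x, y}`, is an
ultrametric similarity, the Gromov product satisfies the hyperbolic inequality with constant `1`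
(`IsDistanceHereditary.four_point_two`, stated for doubled sums). If the inequality with constant
`1/2` fails, two vertices at distance two on the sphere of radius `m`, a common neighbour below
them and one above them form an induced `4`-cycle (`IsDistanceHereditary.four_point_one`).
Conversely an induced `4`-cycle is isometric and violates `1/2`-hyperbolicity.

A cycle on more than four vertices, with a vertex deleted, is an induced path of length at least
three whose ends have a common neighbour, so it is not contained in a distance-hereditary graph.
A cograph has only induced paths of length at most two, and these are isometric, so cographs are
distance-hereditary.
-/

namespace SimpleGraph

variable {V W : Type*} {G : SimpleGraph V} {H : SimpleGraph W}

/-! ### Distances in induced subgraphs -/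

lemma edist_map_le (f : G →g H) (u v : V) : H.edist (f u) (f v) ≤ G.edist u v := by
  by_cases h : G.edist u v = ⊤
  · simp [h]
  · obtain ⟨p, hp⟩ := exists_walk_of_edist_ne_top h
    rw [← hp, ← Walk.length_map f p]
    exact edist_le _

lemma Iso.edist_eq (e : G ≃g H) (u v : V) : H.edist (e u) (e v) = G.edist u v := by
  refine le_antisymm (edist_map_le e.toHom u v) ?_
  simpa using edist_map_le e.symm.toHom (e u) (e v)

lemma edist_le_two {u v : V} (h : u = v ∨ G.Adj u v ∨ ∃ w, G.Adj u w ∧ G.Adj w v) :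
    G.edist u v ≤ 2 := by
  rcases h with rfl | h | ⟨w, h, h'⟩
  · simp
  · exact (edist_le (Walk.cons h Walk.nil)).trans (by norm_num)
  · exact (edist_le (Walk.cons h (Walk.cons h' Walk.nil))).trans (by norm_num)

lemma Subgraph.IsIsometric.isInduced {K : G.Subgraph} (hK : K.IsIsometric) : K.IsInduced := by
  intro u hu v hv h
  have := hK ⟨u, hu⟩ ⟨v, hv⟩
  rw [edist_eq_one_iff_adj.mpr h, edist_eq_one_iff_adj] at this
  exact this

/-- Passing to an induced subgraph can only change distances that are at least two, and can only
increase them. -/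
lemma Subgraph.IsInduced.isIsometric_of_edist_le_two {K : G.Subgraph} (hK : K.IsInduced)
    (h : ∀ u v : K.verts, K.coe.edist u v ≤ 2) : K.IsIsometric := by
  intro u v
  refine le_antisymm ?_ (edist_map_le K.hom u v)
  by_cases h1 : G.edist (u : V) v ≤ 1
  · rcases edist_le_one_iff_adj_or_eq.mp h1 with h1 | h1
    · rw [edist_eq_one_iff_adj.mpr h1]
      exact (edist_eq_one_iff_adj.mpr (hK u.2 v.2 h1)).le
    · simp [Subtype.ext h1]
  · refine (h u v).trans ?_
    have := Order.add_one_le_of_lt (not_le.mp h1)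
    rwa [one_add_one_eq_two] at this

/-- The subgraph induced on the range of an embedding. -/
lemma exists_isInduced_iso_of_embedding (f : H ↪g G) :
    ∃ (K : G.Subgraph) (e : H ≃g K.coe), K.IsInduced ∧ ∀ w, ((e w : K.verts) : V) = f w := by
  refine ⟨(⊤ : G.Subgraph).induce (Set.range f),
    { toEquiv := Equiv.ofInjective f f.injective
      map_rel_iff' := ?_ }, ?_, fun w => rfl⟩
  · intro a b
    change ((⊤ : G.Subgraph).induce (Set.range f)).Adj (f a) (f b) ↔ _
    simp
  · intro u hu v hv h
    exact ⟨hu, hv, h⟩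

/-- Distance-heredity in terms of embeddings: induced paths given as maps preserve distances. -/
lemma IsDistanceHereditary.edist_embedding (hG : G.IsDistanceHereditary) {n : ℕ}
    (f : pathGraph (n + 1) ↪g G) (i j : Fin (n + 1)) :
    G.edist (f i) (f j) = (pathGraph (n + 1)).edist i j := by
  obtain ⟨K, e, hK, he⟩ := exists_isInduced_iso_of_embedding f
  rw [← he, ← he, ← hG K hK ⟨n, ⟨e.symm⟩⟩, e.edist_eq]

/-- A walk of length equal to the distance of its ends realises the distance of any two of its
vertices. -/
lemma Walk.sub_le_dist_getVert {a b : V} (p : G.Walk a b) (hp : p.length = G.dist a b) {i j : ℕ}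
    (hij : i ≤ j) (hj : j ≤ p.length) : j - i ≤ G.dist (p.getVert i) (p.getVert j) := by
  have h1 := dist_le (p.take i)
  have h2 := dist_le (p.drop j)
  have h3 := (Walk.reachable (p.take i)).dist_triangle_left b
  have h4 := (Walk.reachable (p.drop j)).dist_triangle_right (p.getVert i)
  rw [Walk.take_length] at h1
  rw [Walk.drop_length] at h2
  omega

/-- A walk of length equal to the distance of its ends is an induced path. -/
def Walk.pathGraphEmbedding {a b : V} (p : G.Walk a b) (hp : p.length = G.dist a b) :
    pathGraph (p.length + 1) ↪g G where
  toFun i := p.getVert i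
  inj' := by
    have key : ∀ i j : Fin (p.length + 1), i ≤ j → p.getVert i = p.getVert j → i = j := by
      intro i j hij h
      have := p.sub_le_dist_getVert hp (Fin.le_def.mp hij) (by omega)
      rw [h, dist_self] at this
      exact Fin.ext (by have := Fin.le_def.mp hij; omega)
    intro i j h
    rcases le_total i j with hij | hij
    · exact key i j hij h
    · exact (key j i hij h.symm).symm
  map_rel_iff' := by
    have key : ∀ i j : Fin (p.length + 1), i < j →
        (G.Adj (p.getVert i) (p.getVert j) ↔ i.val + 1 = j.val) := by
      intro i j hij
      have hij' := Fin.lt_def.mp hij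
      constructor
      · intro h
        have := p.sub_le_dist_getVert hp hij'.le (by omega)
        rw [dist_eq_one_iff_adj.mpr h] at this
        omega
      · intro h
        rw [← h]
        exact p.adj_getVert_succ (by omega)
    intro i j
    change G.Adj (p.getVert i) (p.getVert j) ↔ _
    rw [pathGraph_adj]
    rcases lt_trichotomy i j with hij | rfl | hij
    · rw [key i j hij]
      have := Fin.lt_def.mp hij
      omega
    · simp
    · rw [G.adj_comm, key j i hij]
      have := Fin.lt_def.mp hij
      omega

/-- In a distance-hereditary graph the vertices of any walk already span a shortest path between
its ends: connected induced subgraphs are isometric. -/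
lemma IsDistanceHereditary.exists_walk_support_subset (hG : G.IsDistanceHereditary) {a b : V}
    (p : G.Walk a b) :
    ∃ q : G.Walk a b, q.support ⊆ p.support ∧ q.length = G.dist a b := by
  set S : Set V := {v | v ∈ p.support} with hS
  have hconn : (G.induce S).Connected := p.connected_induce_support
  obtain ⟨q, hq⟩ := hconn.exists_walk_length_eq_dist ⟨a, p.start_mem_support⟩
    ⟨b, p.end_mem_support⟩
  -- `q` is shortest inside `S`, hence an induced path of `G`, hence isometric in `G`.
  let f := q.pathGraphEmbedding hq
  let g : pathGraph (q.length + 1) ↪g G := f.trans (Embedding.induce S)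
  have h0 : g 0 = a := by
    change ((q.getVert 0 : S) : V) = a
    simp
  have hl : g (Fin.last _) = b := by
    change ((q.getVert q.length : S) : V) = b
    simp
  have hab := hG.edist_embedding g 0 (Fin.last _)
  rw [h0, hl, ← p.reachable.coe_dist_eq_edist,
    ← (pathGraph_preconnected _ 0 (Fin.last q.length)).coe_dist_eq_edist] at hab
  obtain ⟨r, hr⟩ := (pathGraph_preconnected _ 0 (Fin.last q.length)).exists_walk_length_eq_dist
  refine ⟨(r.map g.toHom).copy h0 hl, ?_, ?_⟩
  · intro x hx
    rw [Walk.support_copy, Walk.support_map, List.mem_map] at hx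
    obtain ⟨i, -, rfl⟩ := hx
    exact (f i).2
  · rw [Walk.length_copy, Walk.length_map, hr]
    exact_mod_cast hab.symm

/-! ### Cycles and cographs -/

lemma Walk.le_add_length_of_pathGraph {n : ℕ} {i j : Fin n} (p : (pathGraph n).Walk i j) :
    j.val ≤ i.val + p.length := by
  induction p with
  | nil => simp
  | cons h p ih =>
    rw [pathGraph_adj] at h
    rw [Walk.length_cons]
    omega

/-- Deleting a vertex from a cycle leaves an induced path. -/
def pathGraphEmbeddingCycleGraph (n : ℕ) : pathGraph (n + 1) ↪g cycleGraph (n + 2) where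
  toFun := Fin.castSucc
  inj' := Fin.castSucc_injective _
  map_rel_iff' := by
    intro i j
    change (cycleGraph (n + 2)).Adj i.castSucc j.castSucc ↔ _
    have hi := i.isLt
    have hj := j.isLt
    rw [cycleGraph_adj', pathGraph_adj, Fin.sub_def, Fin.sub_def]
    simp only [Fin.val_castSucc]
    rcases lt_trichotomy i.val j.val with h | h | h
    · rw [show n + 2 - j.val + i.val = n + 2 - (j.val - i.val) by omega,
        show n + 2 - i.val + j.val = (j.val - i.val) + (n + 2) by omega, Nat.add_mod_right,
        Nat.mod_eq_of_lt (by omega), Nat.mod_eq_of_lt (by omega)]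
      omega
    · rw [h, show n + 2 - j.val + j.val = n + 2 by omega, Nat.mod_self]
      omega
    · rw [show n + 2 - i.val + j.val = n + 2 - (i.val - j.val) by omega,
        show n + 2 - j.val + i.val = (i.val - j.val) + (n + 2) by omega, Nat.add_mod_right,
        Nat.mod_eq_of_lt (by omega), Nat.mod_eq_of_lt (by omega)]
      omega

lemma IsDistanceHereditary.not_cycleGraph_isIndContained (hG : G.IsDistanceHereditary) {n : ℕ}
    (hn : 4 < n) : ¬ cycleGraph n ⊴ G := by
  rintro ⟨f⟩
  obtain ⟨m, rfl⟩ : ∃ m, n = m + 2 := ⟨n - 2, by omega⟩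
  -- The ends of the path left after deleting a vertex have that vertex as common neighbour.
  have h := hG.edist_embedding ((pathGraphEmbeddingCycleGraph m).trans f) 0 (Fin.last m)
  have h2 : G.edist (f (Fin.castSucc 0)) (f (Fin.castSucc (Fin.last m))) ≤ 2 := by
    refine edist_le_two (.inr (.inr ⟨f (Fin.last _), ?_, ?_⟩))
    · rw [f.map_adj_iff, cycleGraph_adj]
      left
      simp
    · rw [f.map_adj_iff, cycleGraph_adj]
      left
      rw [← Fin.succ_last, ← Fin.coeSucc_eq_succ, add_sub_cancel_left]
  obtain ⟨p, hp⟩ := (pathGraph_preconnected _ 0 (Fin.last m)).exists_walk_length_eq_edist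
  have h3 := p.le_add_length_of_pathGraph
  have h4 : G.edist (f (Fin.castSucc 0)) (f (Fin.castSucc (Fin.last m))) = p.length :=
    h.trans hp.symm
  rw [h4] at h2
  have h5 : p.length ≤ 2 := by exact_mod_cast h2
  simp at h3
  omega

/-- Induced paths in a cograph have at most three vertices, hence diameter at most two. -/
lemma IsCograph.isDistanceHereditary (hG : G.IsCograph) : G.IsDistanceHereditary := by
  rintro K hK ⟨n, ⟨e⟩⟩
  have hn : n < 3 := by
    by_contra hn
    let f : pathGraph 4 ↪g pathGraph (n + 1) :=
      { toFun := Fin.castLE (by omega)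
        inj' := Fin.castLE_injective _
        map_rel_iff' := by simp [pathGraph_adj] }
    have : K.coe ⊴ G := ⟨⟨⟨Subtype.val, Subtype.val_injective⟩, by
      intro a b; exact hK.adj.symm⟩⟩
    exact hG (IsIndContained.trans ⟨f.trans e.symm.toEmbedding⟩ this)
  refine hK.isIsometric_of_edist_le_two fun u v => ?_
  rw [← e.edist_eq]
  apply edist_le_two
  generalize e u = i
  generalize e v = j
  simp only [pathGraph_adj]
  interval_cases n <;> revert i j <;> decide

/-! ### Four-point inequalities in distance-hereditary graphs -/

/-- `G.JoinedAbove v m x y` means that `x` and `y` are joined by a walk all of whose vertices are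
at distance at least `m` from `v`, i.e. that they lie in the same component of the complement of
the open ball of radius `m` around `v`. -/
def JoinedAbove (G : SimpleGraph V) (v : V) (m : ℕ) (x y : V) : Prop :=
  ∃ p : G.Walk x y, ∀ w ∈ p.support, m ≤ G.dist v w

namespace JoinedAbove

variable {v x y z : V} {m : ℕ}

lemma symm (h : G.JoinedAbove v m x y) : G.JoinedAbove v m y x := by
  obtain ⟨p, hp⟩ := h
  exact ⟨p.reverse, fun w hw => hp w (by simpa using hw)⟩

lemma trans (h : G.JoinedAbove v m x y) (h' : G.JoinedAbove v m y z) :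
    G.JoinedAbove v m x z := by
  obtain ⟨p, hp⟩ := h
  obtain ⟨q, hq⟩ := h'
  refine ⟨p.append q, fun w hw => ?_⟩
  rcases (Walk.mem_support_append_iff p q).mp hw with hw | hw
  · exact hp w hw
  · exact hq w hw

lemma le_left (h : G.JoinedAbove v m x y) : m ≤ G.dist v x := by
  obtain ⟨p, hp⟩ := h
  exact hp x p.start_mem_support

lemma le_right (h : G.JoinedAbove v m x y) : m ≤ G.dist v y :=
  h.symm.le_left

end JoinedAbove

lemma Connected.joinedAbove_zero (hG : G.Connected) (v x y : V) : G.JoinedAbove v 0 x y :=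
  ⟨(hG.preconnected x y).some, fun _ _ => Nat.zero_le _⟩

lemma Walk.dist_add_dist_eq_of_mem_support {a b w : V} (p : G.Walk a b)
    (hp : p.length = G.dist a b) (hw : w ∈ p.support) :
    G.dist a w + G.dist w b = G.dist a b := by
  classical
  have h1 := dist_le (p.takeUntil w hw)
  have h2 := dist_le (p.dropUntil w hw)
  have h3 := congrArg Walk.length (p.take_spec hw)
  rw [Walk.length_append] at h3
  have h4 := (p.takeUntil w hw).reachable.dist_triangle_left b
  omega

/-- If `x` and `y` are not joined outside the ball of radius `m`, a shortest path between them
meets that ball. -/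
lemma Connected.exists_dist_le_of_not_joinedAbove (hG : G.Connected) {v x y : V} {m : ℕ}
    (h : ¬ G.JoinedAbove v (m + 1) x y) :
    ∃ w, G.dist v w ≤ m ∧ G.dist x w + G.dist w y = G.dist x y := by
  obtain ⟨p, hp⟩ := hG.exists_walk_length_eq_dist x y
  rw [JoinedAbove] at h
  push Not at h
  obtain ⟨w, hw, hm⟩ := h p
  exact ⟨w, by omega, p.dist_add_dist_eq_of_mem_support hp hw⟩

/-- The Gromov product at `v` of two vertices not joined outside the ball of radius `m` is at most
`m`. -/
lemma Connected.le_dist_of_not_joinedAbove (hG : G.Connected) {v x y : V} {m : ℕ}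
    (h : ¬ G.JoinedAbove v (m + 1) x y) :
    G.dist v x + G.dist v y ≤ G.dist x y + 2 * m := by
  obtain ⟨w, hw, hd⟩ := hG.exists_dist_le_of_not_joinedAbove h
  have h1 := hG.dist_triangle (u := v) (v := w) (w := x)
  have h2 := hG.dist_triangle (u := v) (v := w) (w := y)
  rw [dist_comm (u := w) (v := x)] at h1
  omega

lemma Connected.joinedAbove_of_add_dist_le (hG : G.Connected) {v x y : V} {m : ℕ}
    (h : m + G.dist x y ≤ G.dist v y) : G.JoinedAbove v m x y := by
  obtain ⟨p, hp⟩ := hG.exists_walk_length_eq_dist x y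
  refine ⟨p, fun w hw => ?_⟩
  have h1 := p.dist_add_dist_eq_of_mem_support hp hw
  have h2 := hG.dist_triangle (u := v) (v := w) (w := y)
  omega

lemma Connected.exists_dist_eq_of_le (hG : G.Connected) {v x : V} {m : ℕ}
    (h : m ≤ G.dist v x) : ∃ w, G.dist v w = m ∧ G.dist w x + m = G.dist v x := by
  obtain ⟨p, hp⟩ := hG.exists_walk_length_eq_dist v x
  have h1 := p.dist_add_dist_eq_of_mem_support hp (p.getVert_mem_support m)
  have h2 := dist_le (p.take m)
  have h3 := dist_le (p.drop m)
  rw [Walk.take_length] at h2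
  rw [Walk.drop_length] at h3
  exact ⟨p.getVert m, by omega, by omega⟩

lemma Connected.exists_joinedAbove_of_le (hG : G.Connected) {v x : V} {m : ℕ}
    (h : m ≤ G.dist v x) :
    ∃ w, G.dist v w = m ∧ G.dist w x + m = G.dist v x ∧ G.JoinedAbove v m w x := by
  obtain ⟨w, hw, hwx⟩ := hG.exists_dist_eq_of_le h
  exact ⟨w, hw, hwx, hG.joinedAbove_of_add_dist_le (by omega)⟩

/-- In a distance-hereditary graph, two vertices at distance `k + 1` from `v` that are joined
outside the ball of radius `k` have the same neighbours at distance `k` from `v`. Indeed, a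
shortest path from `v` to a neighbour `p` of `x`, together with the walk from `x` to `y`, contains
a shortest path from `v` to `y`, whose vertex at distance `k` from `v` can only be `p`. -/
lemma IsDistanceHereditary.adj_of_joinedAbove (hD : G.IsDistanceHereditary) (hG : G.Connected)
    {v x y p : V} {k : ℕ} (hy : G.dist v y = k + 1) (hp : G.dist v p = k) (hpx : G.Adj p x)
    (h : G.JoinedAbove v (k + 1) x y) : G.Adj p y := by
  obtain ⟨q, hq⟩ := h
  obtain ⟨r, hr⟩ := hG.exists_walk_length_eq_dist v p
  obtain ⟨s, hs, hsl⟩ := hD.exists_walk_support_subset (r.append (Walk.cons hpx q))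
  have hnil : ¬ s.Nil := by
    intro hn
    have := Walk.length_eq_zero_iff.mpr hn
    omega
  have hadj := s.adj_penultimate hnil
  have hle : G.dist v s.penultimate ≤ k := by
    have := dist_le (s.take (s.length - 1))
    rw [Walk.take_length] at this
    change G.dist v (s.getVert (s.length - 1)) ≤ k
    omega
  have hge : k ≤ G.dist v s.penultimate := by
    have := hG.dist_triangle (u := v) (v := s.penultimate) (w := y)
    rw [dist_eq_one_iff_adj.mpr hadj] at this
    omega
  have hmem := hs (s.getVert_mem_support (s.length - 1))
  rw [Walk.mem_support_append_iff, Walk.support_cons, List.mem_cons] at hmem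
  suffices s.penultimate = p by rwa [← this]
  rcases hmem with hmem | hmem | hmem
  · have := r.dist_add_dist_eq_of_mem_support hr hmem
    change G.dist v s.penultimate + G.dist s.penultimate p = G.dist v p at this
    exact hG.dist_eq_zero_iff.mp (by omega)
  · exact hmem
  · have := hq _ hmem
    change k + 1 ≤ G.dist v s.penultimate at this
    omega

lemma Connected.exists_adj_dist_add_one (hG : G.Connected) {v x : V} {k : ℕ}
    (h : G.dist v x = k + 1) : ∃ p, G.dist v p = k ∧ G.Adj p x := by
  obtain ⟨p, hp, hpx⟩ := hG.exists_dist_eq_of_le (show k ≤ G.dist v x by omega)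
  exact ⟨p, hp, dist_eq_one_iff_adj.mp (by omega)⟩

/-- Two vertices at the same distance `m > 0` from `v` that are joined outside the open ball of
radius `m` have a common neighbour at distance `m - 1` from `v`. -/
lemma IsDistanceHereditary.exists_common_neighbor (hD : G.IsDistanceHereditary)
    (hG : G.Connected) {v x y : V} {k : ℕ} (hx : G.dist v x = k + 1) (hy : G.dist v y = k + 1)
    (h : G.JoinedAbove v (k + 1) x y) : ∃ p, G.dist v p = k ∧ G.Adj p x ∧ G.Adj p y := by
  obtain ⟨p, hp, hpx⟩ := hG.exists_adj_dist_add_one hx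
  exact ⟨p, hp, hpx, hD.adj_of_joinedAbove hG hy hp hpx h⟩

/-- The Gromov product at `v` of two vertices joined outside the open ball of radius `m` is at
least `m - 1`. -/
lemma IsDistanceHereditary.dist_le_of_joinedAbove (hD : G.IsDistanceHereditary)
    (hG : G.Connected) {v x y : V} {m : ℕ} (h : G.JoinedAbove v m x y) :
    G.dist x y + 2 * m ≤ G.dist v x + G.dist v y + 2 := by
  obtain ⟨a, ha, hax, hja⟩ := hG.exists_joinedAbove_of_le h.le_left
  obtain ⟨b, hb, hby, hjb⟩ := hG.exists_joinedAbove_of_le h.le_right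
  have hab : G.dist a b ≤ 2 := by
    cases m with
    | zero =>
      have h1 := hG.dist_eq_zero_iff.mp ha
      have h2 := hG.dist_eq_zero_iff.mp hb
      rw [← h1, ← h2, dist_self]
      omega
    | succ k =>
      obtain ⟨p, -, hpa, hpb⟩ :=
        hD.exists_common_neighbor hG ha hb ((hja.trans h).trans hjb.symm)
      exact dist_le (Walk.cons hpa.symm (Walk.cons hpb Walk.nil))
  have h1 := hG.dist_triangle (u := x) (v := a) (w := y)
  have h2 := hG.dist_triangle (u := a) (v := b) (w := y)
  rw [dist_comm (u := x) (v := a)] at h1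
  omega

/-- The largest radius outside of which `y` is still joined to both `x` and `z`. -/
lemma Connected.exists_max_joinedAbove (hG : G.Connected) (v x y z : V) :
    ∃ m, G.JoinedAbove v m x y ∧ G.JoinedAbove v m y z ∧
      (¬ G.JoinedAbove v (m + 1) x y ∨ ¬ G.JoinedAbove v (m + 1) y z) := by
  classical
  let P : ℕ → Prop := fun m => G.JoinedAbove v m x y ∧ G.JoinedAbove v m y z
  have h0 : P 0 := ⟨hG.joinedAbove_zero v x y, hG.joinedAbove_zero v y z⟩
  have hm : P (Nat.findGreatest P (G.dist v y)) :=
    Nat.findGreatest_spec (Nat.zero_le _) h0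
  refine ⟨_, hm.1, hm.2, ?_⟩
  by_contra! hcon
  have : P (Nat.findGreatest P (G.dist v y) + 1) := hcon
  have := Nat.le_findGreatest this.1.le_right this
  omega

/-- The four-point inequality for doubled Gromov products based at `v`, with constant two. -/
lemma IsDistanceHereditary.four_point_two (hD : G.IsDistanceHereditary) (hG : G.Connected)
    (v x y z : V) :
    G.dist x z + G.dist v y ≤ G.dist x y + G.dist v z + 2 ∨
      G.dist x z + G.dist v y ≤ G.dist y z + G.dist v x + 2 := by
  obtain ⟨m, hxy, hyz, h⟩ := hG.exists_max_joinedAbove v x y z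
  have := hD.dist_le_of_joinedAbove hG (hxy.trans hyz)
  rcases h with h | h <;> have := hG.le_dist_of_not_joinedAbove h <;> omega

/-- If the Gromov product of `y` and `z` at `v` is at least `m`, then shortest paths from `v` to
`y` and to `z` can be chosen with a common vertex at distance `m` from `v`. -/
lemma IsDistanceHereditary.exists_common_vertex (hD : G.IsDistanceHereditary) (hG : G.Connected)
    {v y z : V} {m : ℕ} (h : G.dist y z + 2 * m ≤ G.dist v y + G.dist v z) :
    ∃ w, G.dist v w = m ∧ G.dist w y + m = G.dist v y ∧ G.dist w z + m = G.dist v z := by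
  by_cases hj : G.JoinedAbove v (m + 1) y z
  · obtain ⟨a, ha, hay, hja⟩ := hG.exists_joinedAbove_of_le hj.le_left
    obtain ⟨b, hb, hbz, hjb⟩ := hG.exists_joinedAbove_of_le hj.le_right
    obtain ⟨p, hp, hpa, hpb⟩ :=
      hD.exists_common_neighbor hG ha hb ((hja.trans hj).trans hjb.symm)
    have key : ∀ {a y : V}, G.Adj p a → G.dist a y + (m + 1) = G.dist v y →
        G.dist p y + m = G.dist v y := by
      intro a y hpa hay
      have h1 := hG.dist_triangle (u := p) (v := a) (w := y)
      have h2 := hG.dist_triangle (u := v) (v := p) (w := y)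
      rw [dist_eq_one_iff_adj.mpr hpa] at h1
      omega
    exact ⟨p, hp, key hpa hay, key hpb hbz⟩
  · obtain ⟨w, hw, hd⟩ := hG.exists_dist_le_of_not_joinedAbove hj
    have h1 := hG.dist_triangle (u := v) (v := w) (w := y)
    have h2 := hG.dist_triangle (u := v) (v := w) (w := z)
    rw [dist_comm (u := y) (v := w)] at hd
    exact ⟨w, by omega, by omega, by omega⟩

lemma cycleGraph_four_isIndContained {a b c d : V} (hab : G.Adj a b) (hbc : G.Adj b c)
    (hcd : G.Adj c d) (hda : G.Adj d a) (hac : ¬ G.Adj a c) (hbd : ¬ G.Adj b d) (hac' : a ≠ c)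
    (hbd' : b ≠ d) : cycleGraph 4 ⊴ G := by
  refine ⟨⟨⟨![a, b, c, d], ?_⟩, ?_⟩⟩
  · intro i j
    have := hab.ne
    have := hbc.ne
    have := hcd.ne
    have := hda.ne
    fin_cases i <;> fin_cases j <;> simp [*, Ne.symm]
  · intro i j
    change G.Adj (![a, b, c, d] i) (![a, b, c, d] j) ↔ _
    rw [cycleGraph_adj]
    have := hab.symm
    have := hbc.symm
    have := hcd.symm
    have := hda.symm
    rw [G.adj_comm] at hac hbd
    have : ¬ G.Adj a c := by rwa [G.adj_comm]
    have : ¬ G.Adj b d := by rwa [G.adj_comm]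
    fin_cases i <;> fin_cases j <;> simp [*] <;> decide

/-- A violation of the four-point inequality with constant one, at the largest `m` outside of
whose open ball `y` is joined to `x` and `z`, yields two vertices `a`, `b` at mutual distance two
on the sphere of radius `m`, both on shortest paths from `v` to `y`. A common neighbour one step
closer to `v` and one towards `y` complete them to an induced `4`-cycle. -/
lemma IsDistanceHereditary.four_point_one (hD : G.IsDistanceHereditary) (hG : G.Connected)
    (hC : ¬ cycleGraph 4 ⊴ G) (v x y z : V) :
    G.dist x z + G.dist v y ≤ G.dist x y + G.dist v z + 1 ∨
      G.dist x z + G.dist v y ≤ G.dist y z + G.dist v x + 1 := by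
  by_contra! hcon
  obtain ⟨h1, h2⟩ := hcon
  obtain ⟨m, hxy, hyz, h⟩ := hG.exists_max_joinedAbove v x y z
  have hle := hD.dist_le_of_joinedAbove hG (hxy.trans hyz)
  have hge : G.dist v x + G.dist v z + 2 ≤ G.dist x z + 2 * m := by
    rcases h with h | h <;> have := hG.le_dist_of_not_joinedAbove h <;> omega
  obtain ⟨a, hva, hax, hay⟩ := hD.exists_common_vertex hG (v := v) (y := x) (z := y) (m := m)
    (by omega)
  obtain ⟨b, hvb, hby, hbz⟩ := hD.exists_common_vertex hG (v := v) (y := y) (z := z) (m := m)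
    (by omega)
  have hab : 2 ≤ G.dist a b := by
    have h3 := hG.dist_triangle (u := x) (v := a) (w := z)
    have h4 := hG.dist_triangle (u := a) (v := b) (w := z)
    rw [dist_comm (u := x) (v := a)] at h3
    omega
  have hne : a ≠ b := by
    rintro rfl
    simp at hab
  have hnadj : ¬ G.Adj a b := by
    intro hadj
    rw [dist_eq_one_iff_adj.mpr hadj] at hab
    omega
  have hm : m ≠ 0 := by
    rintro rfl
    exact hne ((hG.dist_eq_zero_iff.mp hva).symm.trans (hG.dist_eq_zero_iff.mp hvb))
  have hmy : m ≠ G.dist v y := by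
    intro hmy
    exact hne ((hG.dist_eq_zero_iff.mp (by omega)).trans
      (hG.dist_eq_zero_iff.mp (by omega : G.dist b y = 0)).symm)
  obtain ⟨k, rfl⟩ := Nat.exists_eq_succ_of_ne_zero hm
  -- A neighbour of `w` on a shortest path from `w` to `y`, when `w` lies between `v` and `y`.
  have up : ∀ w, G.dist v w = k + 1 → G.dist w y + (k + 1) = G.dist v y →
      ∃ q, G.Adj w q ∧ G.dist v q = k + 2 ∧ G.JoinedAbove v (k + 2) q y := by
    intro w hvw hwy
    obtain ⟨j, hj⟩ : ∃ j, G.dist y w = j + 1 :=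
      ⟨G.dist w y - 1, by rw [dist_comm (u := y)]; omega⟩
    obtain ⟨q, hq, hqw⟩ := hG.exists_adj_dist_add_one hj
    rw [dist_comm (u := y)] at hq hj
    have h3 := hG.dist_triangle (u := v) (v := w) (w := q)
    have h4 := hG.dist_triangle (u := v) (v := q) (w := y)
    rw [dist_eq_one_iff_adj.mpr hqw.symm] at h3
    exact ⟨q, hqw.symm, by omega, hG.joinedAbove_of_add_dist_le (by omega)⟩
  obtain ⟨q, haq, hq, hqy⟩ := up a hva hay
  obtain ⟨q', hbq', hq', hqy'⟩ := up b hvb hby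
  have hbq := hD.adj_of_joinedAbove hG hq hvb hbq' (hqy'.trans hqy.symm)
  have hja : G.JoinedAbove v (k + 1) a b :=
    (hG.joinedAbove_of_add_dist_le (by omega : k + 1 + G.dist a y ≤ G.dist v y)).trans
      (hG.joinedAbove_of_add_dist_le (by omega : k + 1 + G.dist b y ≤ G.dist v y)).symm
  obtain ⟨p, hp, hpa, hpb⟩ := hD.exists_common_neighbor hG hva hvb hja
  have hpq : ¬ G.Adj p q ∧ p ≠ q := by
    constructor
    · intro hadj
      have := hG.dist_triangle (u := v) (v := p) (w := q)
      rw [dist_eq_one_iff_adj.mpr hadj] at this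
      omega
    · rintro rfl
      omega
  exact hC (cycleGraph_four_isIndContained hpa.symm hpb hbq haq.symm hnadj hpq.1 hne hpq.2)

/-! ### Hyperbolicity -/

lemma gapOfLargest_le {a b c δ : ℝ} (ha : a ≤ b + δ ∨ a ≤ c + δ) (hb : b ≤ a + δ ∨ b ≤ c + δ)
    (hc : c ≤ a + δ ∨ c ≤ b + δ) : gapOfLargest a b c ≤ δ := by
  unfold gapOfLargest
  grind

/-- The constant is halved because `fourPointDelta` compares half-sums of distances. -/
lemma isHyperbolic_of_four_point {k : ℕ}
    (h : ∀ v x y z : V, G.dist x z + G.dist v y ≤ G.dist x y + G.dist v z + k ∨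
      G.dist x z + G.dist v y ≤ G.dist y z + G.dist v x + k) :
    G.IsHyperbolic ((k : ℝ) / 2) := by
  have h' : ∀ v x y z : V, (G.dist x z : ℝ) + G.dist v y ≤ G.dist x y + G.dist v z + k ∨
      (G.dist x z : ℝ) + G.dist v y ≤ G.dist y z + G.dist v x + k := by
    exact_mod_cast h
  intro x y u v
  unfold fourPointDelta
  -- Each of the three sums, in turn, as the left-hand side of the inequality based at `v`.
  have h1 := h' v x y u
  have h2 := h' v x u y
  have h3 := h' v u x y
  rw [G.dist_comm (u := x) (v := u)] at h1 h2
  rw [G.dist_comm (u := y) (v := u)] at h1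
  rw [G.dist_comm (u := u) (v := v)]
  refine gapOfLargest_le ?_ ?_ ?_
  · exact h2.imp (fun _ => by linarith) (fun _ => by linarith)
  · exact h1.imp (fun _ => by linarith) (fun _ => by linarith)
  · exact h3.symm.imp (fun _ => by linarith) (fun _ => by linarith)

lemma IsHyperbolic.mono {δ ε : ℝ} (h : G.IsHyperbolic δ) (hδ : δ ≤ ε) : G.IsHyperbolic ε :=
  fun x y u v => (h x y u v).trans hδ

lemma dist_eq_two {u v w : V} (huw : G.Adj u w) (hwv : G.Adj w v) (hne : u ≠ v)
    (h : ¬ G.Adj u v) : G.dist u v = 2 := by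
  have hr : G.Reachable u v := huw.reachable.trans hwv.reachable
  have h1 := hr.one_lt_dist_of_ne_of_not_adj hne h
  have h2 := dist_le (Walk.cons huw (Walk.cons hwv Walk.nil))
  simp only [Walk.length_cons, Walk.length_nil] at h2
  omega

lemma not_isHyperbolic_half_of_cycleGraph_four (h : cycleGraph 4 ⊴ G) :
    ¬ G.IsHyperbolic (1 / 2) := by
  obtain ⟨f⟩ := h
  intro hH
  have hadj : ∀ i j, (cycleGraph 4).Adj i j → G.dist (f i) (f j) = 1 := fun i j hij =>
    dist_eq_one_iff_adj.mpr (f.map_adj_iff.mpr hij)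
  have htwo : ∀ i k j, (cycleGraph 4).Adj i k → (cycleGraph 4).Adj k j → i ≠ j →
      ¬ (cycleGraph 4).Adj i j → G.dist (f i) (f j) = 2 := fun i k j hik hkj hij h =>
    dist_eq_two (f.map_adj_iff.mpr hik) (f.map_adj_iff.mpr hkj) (f.injective.ne hij)
      (fun h' => h (f.map_adj_iff.mp h'))
  -- Pairing opposite vertices, the sum of distances is `4`; the two other sums are `2`.
  have := hH (f 0) (f 2) (f 1) (f 3)
  unfold fourPointDelta gapOfLargest at this
  rw [htwo 1 0 3 (by decide) (by decide) (by decide) (by decide),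
    htwo 0 1 2 (by decide) (by decide) (by decide) (by decide),
    hadj 1 0 (by decide), hadj 3 2 (by decide), hadj 1 2 (by decide), hadj 3 0 (by decide)] at this
  norm_num at this

lemma containsIsometric_cycleGraph_four_iff :
    G.ContainsIsometric (cycleGraph 4) ↔ cycleGraph 4 ⊴ G := by
  constructor
  · rintro ⟨K, ⟨e⟩, hK⟩
    exact isIndContained_iff_exists_iso_subgraph.mpr ⟨K, e.symm, hK.isInduced⟩
  · rintro ⟨f⟩
    obtain ⟨K, e, hK, -⟩ := exists_isInduced_iso_of_embedding f
    refine ⟨K, ⟨e.symm⟩, hK.isIsometric_of_edist_le_two fun u v => ?_⟩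
    rw [← e.symm.edist_eq]
    generalize e.symm u = i
    generalize e.symm v = j
    exact edist_le_two (by revert i j; decide)

lemma IsHyperbolic.hyperbolicity_le {k : ℕ} (h : G.IsHyperbolic ((k : ℝ) / 2)) :
    G.hyperbolicity ≤ (k : ℝ≥0∞) / 2 :=
  iInf₂_le k h

lemma hyperbolicity_eq_one_iff (h : G.IsHyperbolic 1) :
    G.hyperbolicity = 1 ↔ ¬ G.IsHyperbolic (1 / 2) := by
  constructor
  · intro h1 hH
    have := IsHyperbolic.hyperbolicity_le (G := G) (k := 1) (by simpa using hH)
    rw [h1] at this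
    have h2 : ((1 : ℕ) : ℝ≥0∞) / 2 < 1 := by
      rw [Nat.cast_one, one_div]
      exact ENNReal.one_half_lt_one
    exact absurd this (not_le.mpr h2)
  · intro hH
    have hdiv : (2 : ℝ≥0∞) / 2 = 1 := ENNReal.div_self (by norm_num) (by norm_num)
    apply le_antisymm
    · have := IsHyperbolic.hyperbolicity_le (G := G) (k := 2) (by norm_num; exact h)
      rwa [Nat.cast_ofNat, hdiv] at this
    · refine le_iInf₂ fun k hk => ?_
      have hk2 : 2 ≤ k := by
        by_contra! hlt
        refine hH (hk.mono ?_)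
        have : (k : ℝ) ≤ 1 := by exact_mod_cast Nat.lt_succ_iff.mp hlt
        linarith
      rw [← hdiv]
      gcongr
      exact_mod_cast hk2

namespace IsDistanceHereditary

lemma isHyperbolic_one (hD : G.IsDistanceHereditary) (hG : G.Connected) : G.IsHyperbolic 1 := by
  simpa using isHyperbolic_of_four_point (k := 2) (hD.four_point_two hG)

lemma isHyperbolic_half_iff (hD : G.IsDistanceHereditary) (hG : G.Connected) :
    G.IsHyperbolic (1 / 2) ↔ ¬ cycleGraph 4 ⊴ G :=
  ⟨fun h hC => not_isHyperbolic_half_of_cycleGraph_four hC h, fun hC => by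
    simpa using isHyperbolic_of_four_point (k := 1) (hD.four_point_one hG hC)⟩

lemma isChordal_iff (hD : G.IsDistanceHereditary) : G.IsChordal ↔ ¬ cycleGraph 4 ⊴ G := by
  refine ⟨fun h => h 4 (by norm_num) (by norm_num), fun h n _ hn => ?_⟩
  obtain rfl | hn := (Nat.succ_le_of_lt hn).eq_or_lt
  · exact h
  · exact hD.not_cycleGraph_isIndContained hn

end IsDistanceHereditary

end SimpleGraph

theorem mainTheorem7 {V : Type*} (G : SimpleGraph V) (hG : G.Connected) :
    (G.IsDistanceHereditary →
      G.IsHyperbolic 1 ∧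
      (G.IsHyperbolic (1 / 2) ↔ G.IsChordal) ∧
      (G.IsChordal ↔ ¬ (SimpleGraph.cycleGraph 4).IsIndContained G)) ∧
    (G.IsCograph →
      G.IsHyperbolic 1 ∧
      (G.hyperbolicity = 1 ↔ G.ContainsIsometric (SimpleGraph.cycleGraph 4))) := by
  refine ⟨fun hD => ⟨hD.isHyperbolic_one hG, ?_, hD.isChordal_iff⟩, fun hC => ?_⟩
  · rw [hD.isHyperbolic_half_iff hG, hD.isChordal_iff]
  · have hD := hC.isDistanceHereditary
    refine ⟨hD.isHyperbolic_one hG, ?_⟩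
    rw [SimpleGraph.hyperbolicity_eq_one_iff (hD.isHyperbolic_one hG),
      hD.isHyperbolic_half_iff hG, not_not, SimpleGraph.containsIsometric_cycleGraph_four_iff]
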